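/- Let $(M,g)$ be a compact connected smooth Riemannian manifold without boundary, of dimension $n>2$ (oriented or not). Let $0<m\le\infty$ (with $\frac1\infty=0$) and $\lambda\in\mathbb R$ be constants, and suppose that $(M,g)$ is $m$-quasi Einstein, that is, there is a smooth vector field $X$ on $M$ with $$\mathrm{Ric}+\tfrac12\mathcal L_Xg-\tfrac1m X^\flat\otimes X^\flat=\lambda g ,$$ where $X^\flat$ is the $1$-form dual to $X$. Let $f\in C^\infty(M)$ be a potential function, that is (with the same $m$ and $\lambda$) $$\mathrm{Ric}+\nabla^2f-\tfrac1m\,df\otimes df=\lambda g ;$$ this is the first equation with $\nabla f$ in place of $X$, so it holds in particular when $X=\nabla f$. Call $\xi\in C^\infty(M)$ a Hodge--de Rham potential of $X$ if $X=W+\nabla\xi$ for some smooth vector field $W$ with $\operatorname{div}W=0$. Then $X$ has a Hodge--de Rham potential, and for every Hodge--de Rham potential $\xi$ of $X$ there is a constant $c\in\mathbb R$ with $f=\xi+c$ on $M$. -/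

import Mathlib

open Bundle Manifold VectorField FiberBundle
open scoped ContDiff Topology ENNReal

noncomputable section

namespace QuasiEinstein

variable {E : Type*} [NormedAddCommGroup E] [NormedSpace ℝ E]
  {H : Type*} [TopologicalSpace H] {I : ModelWithCorners ℝ E H}
  {M : Type*} [TopologicalSpace M] [ChartedSpace H M] [IsManifold I ∞ M]
  [RiemannianBundle (fun x : M ↦ TangentSpace I x)]

/-- The Koszul expression, which equals `2 g(∇_X Y, Z)` at the point `x`. -/
def koszul (X Y Z : Π x : M, TangentSpace I x) (x : M) : ℝ :=
  mvfderiv I (fun y ↦ inner ℝ (Y y) (Z y)) x (X x)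
    + mvfderiv I (fun y ↦ inner ℝ (Z y) (X y)) x (Y x)
    - mvfderiv I (fun y ↦ inner ℝ (X y) (Y y)) x (Z x)
    + inner ℝ (mlieBracket I X Y x) (Z x)
    - inner ℝ (mlieBracket I Y Z x) (X x)
    + inner ℝ (mlieBracket I Z X x) (Y x)

/-- Two tangent vectors coincide if they have the same inner product with the values of all
vector fields that are differentiable at the point. -/
theorem ext_inner_field {x : M} {u v : TangentSpace I x}
    (h : ∀ Z : Π x : M, TangentSpace I x, MDiffAt (T% Z) x →
      (inner ℝ u (Z x) : ℝ) = inner ℝ v (Z x)) : u = v := by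
  refine ext_inner_right ℝ fun w ↦ ?_
  simpa using h (extend E w) (mdifferentiableAt_extend ..)

variable [IsContMDiffRiemannianBundle I ∞ E (fun x : M ↦ TangentSpace I x)]

theorem mdiffAt_inner {x : M} {X Y : Π x : M, TangentSpace I x}
    (hX : MDiffAt (T% X) x) (hY : MDiffAt (T% Y) x) :
    MDiffAt (fun y ↦ (inner ℝ (X y) (Y y) : ℝ)) x :=
  haveI : IsContMDiffRiemannianBundle I 1 E (fun x : M ↦ TangentSpace I x) :=
    IsContMDiffRiemannianBundle.of_le (n := ∞) (by norm_cast)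
  MDifferentiableAt.inner_bundle (E := fun x : M ↦ TangentSpace I x) (F := E) (b := id) hX hY

theorem mvfderiv_inner_smul_right {x : M} {f : M → ℝ} {X Y : Π x : M, TangentSpace I x}
    (hf : MDiffAt f x) (hX : MDiffAt (T% X) x) (hY : MDiffAt (T% Y) x) (v : TangentSpace I x) :
    mvfderiv I (fun y ↦ inner ℝ (X y) ((f • Y) y)) x v
      = f x * mvfderiv I (fun y ↦ inner ℝ (X y) (Y y)) x v
        + inner ℝ (X x) (Y x) * mvfderiv I f x v := by
  have h : (fun y ↦ (inner ℝ (X y) ((f • Y) y) : ℝ)) = fun y ↦ f y * inner ℝ (X y) (Y y) := by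
    funext y
    simp [inner_smul_right]
  rw [h, mvfderiv_fun_mul hf (mdiffAt_inner hX hY)]
  simp

theorem mvfderiv_inner_smul_left {x : M} {f : M → ℝ} {X Y : Π x : M, TangentSpace I x}
    (hf : MDiffAt f x) (hX : MDiffAt (T% X) x) (hY : MDiffAt (T% Y) x) (v : TangentSpace I x) :
    mvfderiv I (fun y ↦ inner ℝ ((f • X) y) (Y y)) x v
      = f x * mvfderiv I (fun y ↦ inner ℝ (X y) (Y y)) x v
        + inner ℝ (X x) (Y x) * mvfderiv I f x v := by
  simp_rw [real_inner_comm (Y _)] at *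
  exact mvfderiv_inner_smul_right hf hY hX v

theorem mvfderiv_inner_add_right {x : M} {X Y Y' : Π x : M, TangentSpace I x}
    (hX : MDiffAt (T% X) x) (hY : MDiffAt (T% Y) x) (hY' : MDiffAt (T% Y') x)
    (v : TangentSpace I x) :
    mvfderiv I (fun y ↦ inner ℝ (X y) ((Y + Y') y)) x v
      = mvfderiv I (fun y ↦ inner ℝ (X y) (Y y)) x v
        + mvfderiv I (fun y ↦ inner ℝ (X y) (Y' y)) x v := by
  have h : (fun y ↦ (inner ℝ (X y) ((Y + Y') y) : ℝ))
      = fun y ↦ inner ℝ (X y) (Y y) + inner ℝ (X y) (Y' y) := by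
    funext y
    simp [inner_add_right]
  rw [h, mvfderiv_fun_add (mdiffAt_inner hX hY) (mdiffAt_inner hX hY')]
  simp

theorem mvfderiv_inner_add_left {x : M} {X X' Y : Π x : M, TangentSpace I x}
    (hX : MDiffAt (T% X) x) (hX' : MDiffAt (T% X') x) (hY : MDiffAt (T% Y) x)
    (v : TangentSpace I x) :
    mvfderiv I (fun y ↦ inner ℝ ((X + X') y) (Y y)) x v
      = mvfderiv I (fun y ↦ inner ℝ (X y) (Y y)) x v
        + mvfderiv I (fun y ↦ inner ℝ (X' y) (Y y)) x v := by
  simp_rw [real_inner_comm (Y _)] at *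
  exact mvfderiv_inner_add_right hY hX hX' v

variable [FiniteDimensional ℝ E]

theorem koszul_smul_left {x : M} {f : M → ℝ} {X Y Z : Π x : M, TangentSpace I x}
    (hf : MDiffAt f x) (hX : MDiffAt (T% X) x) (hY : MDiffAt (T% Y) x) (hZ : MDiffAt (T% Z) x) :
    koszul (f • X) Y Z x = f x * koszul X Y Z x := by
  rw [koszul, koszul, mvfderiv_inner_smul_left hf hX hY, mvfderiv_inner_smul_right hf hZ hX,
    mlieBracket_smul_left hf hX, mlieBracket_smul_right hf hX]
  simp [inner_add_left, inner_smul_left, inner_smul_right, real_inner_comm]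
  rw [real_inner_comm (Z x) (X x)]
  ring

theorem koszul_smul_right {x : M} {f : M → ℝ} {X Y Z : Π x : M, TangentSpace I x}
    (hf : MDiffAt f x) (hX : MDiffAt (T% X) x) (hY : MDiffAt (T% Y) x) (hZ : MDiffAt (T% Z) x) :
    koszul X Y (f • Z) x = f x * koszul X Y Z x := by
  rw [koszul, koszul, mvfderiv_inner_smul_left hf hZ hX, mvfderiv_inner_smul_right hf hY hZ,
    mlieBracket_smul_left hf hZ, mlieBracket_smul_right hf hZ]
  simp [inner_add_left, inner_smul_left, inner_smul_right]
  rw [real_inner_comm (Y x) (Z x)]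
  ring

theorem koszul_smul_middle {x : M} {f : M → ℝ} {X Y Z : Π x : M, TangentSpace I x}
    (hf : MDiffAt f x) (hX : MDiffAt (T% X) x) (hY : MDiffAt (T% Y) x) (hZ : MDiffAt (T% Z) x) :
    koszul X (f • Y) Z x
      = f x * koszul X Y Z x + 2 * (mvfderiv I f x (X x) * inner ℝ (Y x) (Z x)) := by
  rw [koszul, koszul, mvfderiv_inner_smul_left hf hY hZ, mvfderiv_inner_smul_right hf hX hY,
    mlieBracket_smul_left hf hY, mlieBracket_smul_right hf hY]
  simp [inner_add_left, inner_smul_left, inner_smul_right]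
  rw [real_inner_comm (X x) (Y x)]
  ring

theorem koszul_add_left {x : M} {X X' Y Z : Π x : M, TangentSpace I x}
    (hX : MDiffAt (T% X) x) (hX' : MDiffAt (T% X') x) (hY : MDiffAt (T% Y) x)
    (hZ : MDiffAt (T% Z) x) :
    koszul (X + X') Y Z x = koszul X Y Z x + koszul X' Y Z x := by
  rw [koszul, koszul, koszul, mvfderiv_inner_add_left hX hX' hY, mvfderiv_inner_add_right hZ hX hX',
    mlieBracket_add_left hX hX', mlieBracket_add_right hX hX']
  simp [inner_add_left, inner_add_right]
  ring

theorem koszul_add_right {x : M} {X Y Z Z' : Π x : M, TangentSpace I x}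
    (hX : MDiffAt (T% X) x) (hY : MDiffAt (T% Y) x) (hZ : MDiffAt (T% Z) x)
    (hZ' : MDiffAt (T% Z') x) :
    koszul X Y (Z + Z') x = koszul X Y Z x + koszul X Y Z' x := by
  rw [koszul, koszul, koszul, mvfderiv_inner_add_left hZ hZ' hX, mvfderiv_inner_add_right hY hZ hZ',
    mlieBracket_add_left hZ hZ', mlieBracket_add_right hZ hZ']
  simp [inner_add_left, inner_add_right]
  ring

theorem koszul_add_middle {x : M} {X Y Y' Z : Π x : M, TangentSpace I x}
    (hX : MDiffAt (T% X) x) (hY : MDiffAt (T% Y) x) (hY' : MDiffAt (T% Y') x)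
    (hZ : MDiffAt (T% Z) x) :
    koszul X (Y + Y') Z x = koszul X Y Z x + koszul X Y' Z x := by
  rw [koszul, koszul, koszul, mvfderiv_inner_add_left hY hY' hZ, mvfderiv_inner_add_right hX hY hY',
    mlieBracket_add_left hY hY', mlieBracket_add_right hY hY']
  simp [inner_add_left, inner_add_right]
  ring

theorem koszul_tensorial_left {x : M} {Y Z : Π x : M, TangentSpace I x}
    (hY : MDiffAt (T% Y) x) (hZ : MDiffAt (T% Z) x) :
    TensorialAt I E (fun X : Π x : M, TangentSpace I x ↦ koszul X Y Z x) x where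
  smul hf hX := koszul_smul_left hf hX hY hZ
  add hX hX' := koszul_add_left hX hX' hY hZ

theorem koszul_tensorial_right {x : M} {X Y : Π x : M, TangentSpace I x}
    (hX : MDiffAt (T% X) x) (hY : MDiffAt (T% Y) x) :
    TensorialAt I E (fun Z : Π x : M, TangentSpace I x ↦ koszul X Y Z x) x where
  smul hf hZ := koszul_smul_right hf hX hY hZ
  add hZ hZ' := koszul_add_right hX hY hZ hZ'

instance tangentSpace_finiteDimensional (x : M) : FiniteDimensional ℝ (TangentSpace I x) :=
  inferInstanceAs (FiniteDimensional ℝ E)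

instance tangentSpace_completeSpace (x : M) : CompleteSpace (TangentSpace I x) :=
  FiniteDimensional.complete ℝ (TangentSpace I x)

open Classical in
/-- The Koszul form of `Y` at `x`: the bilinear form `(v, w) ↦ 2 g(∇_v Y, w)` on the tangent
space at `x` (and `0` when `Y` is not differentiable at `x`). -/
def koszulForm (Y : Π x : M, TangentSpace I x) (x : M) :
    TangentSpace I x →L[ℝ] TangentSpace I x →L[ℝ] ℝ :=
  if hY : MDiffAt (T% Y) x then
    TensorialAt.mkHom₂ (fun X Z ↦ koszul X Y Z x) x
      (fun _ hZ ↦ koszul_tensorial_left hY hZ) (fun _ hX ↦ koszul_tensorial_right hX hY)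
  else 0

theorem koszulForm_apply {X Y Z : Π x : M, TangentSpace I x} {x : M}
    (hX : MDiffAt (T% X) x) (hY : MDiffAt (T% Y) x) (hZ : MDiffAt (T% Z) x) :
    koszulForm Y x (X x) (Z x) = koszul X Y Z x := by
  rw [koszulForm, dif_pos hY]
  exact TensorialAt.mkHom₂_apply _ _ hX hZ

/-- The covariant derivative of `Y` at `x`, as the linear map `v ↦ ∇_v Y`: it is obtained from the
Koszul formula through the Riesz isomorphism of the tangent space at `x`. -/
def leviCivitaFun (Y : Π x : M, TangentSpace I x) (x : M) :
    TangentSpace I x →L[ℝ] TangentSpace I x :=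
  LinearMap.toContinuousLinearMap
    { toFun := fun v ↦
        (InnerProductSpace.toDual ℝ (TangentSpace I x)).symm ((1 / 2 : ℝ) • koszulForm Y x v)
      map_add' := fun v w ↦ by simp
      map_smul' := fun c v ↦ by
        rw [ContinuousLinearMap.map_smul, smul_comm, map_smulₛₗ]
        simp }

theorem inner_leviCivitaFun {Y : Π x : M, TangentSpace I x} {x : M} (v w : TangentSpace I x) :
    inner ℝ (leviCivitaFun Y x v) w = 1 / 2 * koszulForm Y x v w := by
  simp [leviCivitaFun, inner_smul_left]

theorem inner_leviCivitaFun_field {X Y Z : Π x : M, TangentSpace I x} {x : M}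
    (hX : MDiffAt (T% X) x) (hY : MDiffAt (T% Y) x) (hZ : MDiffAt (T% Z) x) :
    inner ℝ (leviCivitaFun Y x (X x)) (Z x) = 1 / 2 * koszul X Y Z x := by
  rw [inner_leviCivitaFun, koszulForm_apply hX hY hZ]

variable (I M) in
/-- The Levi-Civita connection of the Riemannian metric. -/
def leviCivita : CovariantDerivative I E (TangentSpace I : M → Type _) where
  toFun := leviCivitaFun
  isCovariantDerivativeOnUniv :=
    { add := by
        intro Y Y' x hY hY' _
        ext1 v
        refine ext_inner_field fun Z hZ ↦ ?_
        have hv := mdifferentiableAt_extend (I := I) (F := E) v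
        have h := koszul_add_middle hv hY hY' hZ
        have hs := mdifferentiableAt_add_section hY hY'
        have e := fun (W : Π x : M, TangentSpace I x) (hW : MDiffAt (T% W) x) ↦ inner_leviCivitaFun_field hv hW hZ
        simp only [extend_apply_self] at e
        rw [e _ hs, h]
        simp only [add_apply, inner_add_left, e _ hY, e _ hY']
        ring
      leibniz := by
        intro Y f x hY hf _
        ext1 v
        refine ext_inner_field fun Z hZ ↦ ?_
        have hv := mdifferentiableAt_extend (I := I) (F := E) v
        have h := koszul_smul_middle hf hv hY hZ
        have hs := hf.smul_section hY
        have e := fun (W : Π x : M, TangentSpace I x) (hW : MDiffAt (T% W) x) ↦ inner_leviCivitaFun_field hv hW hZ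
        simp only [extend_apply_self] at e h
        rw [e _ hs, h]
        simp only [add_apply, smul_apply,
          ContinuousLinearMap.smulRight_apply, inner_add_left, inner_smul_left, e _ hY]
        simp
        ring }

/-- The Levi-Civita connection is torsion-free. -/
theorem leviCivita_torsion : (leviCivita I M).torsion = 0 := by
  rw [CovariantDerivative.torsion_eq_zero_iff]
  intro X Y x hX hY
  refine ext_inner_field fun Z hZ ↦ ?_
  have h1 := inner_leviCivitaFun_field hX hY hZ
  have h2 := inner_leviCivitaFun_field hY hX hZ
  change inner ℝ (leviCivitaFun Y x (X x) - leviCivitaFun X x (Y x)) (Z x) = _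
  rw [inner_sub_left, h1, h2, koszul, koszul, mlieBracket_swap_apply (V := Y) (W := X),
    mlieBracket_swap_apply (V := X) (W := Z), mlieBracket_swap_apply (V := Z) (W := Y)]
  simp_rw [real_inner_comm (X _) (Z _), real_inner_comm (Y _) (Z _), real_inner_comm (Y _) (X _)]
  simp only [inner_neg_left]
  ring

/-- The Levi-Civita connection is compatible with the metric. -/
theorem mvfderiv_inner_eq {x : M} {X Y Z : Π x : M, TangentSpace I x}
    (hX : MDiffAt (T% X) x) (hY : MDiffAt (T% Y) x) (hZ : MDiffAt (T% Z) x) :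
    mvfderiv I (fun y ↦ inner ℝ (Y y) (Z y)) x (X x)
      = inner ℝ (leviCivita I M Y x (X x)) (Z x) + inner ℝ (Y x) (leviCivita I M Z x (X x)) := by
  have h1 := inner_leviCivitaFun_field hX hY hZ
  have h2 := inner_leviCivitaFun_field hX hZ hY
  rw [real_inner_comm (leviCivita I M Z x (X x)) (Y x)]
  change _ = inner ℝ (leviCivitaFun Y x (X x)) (Z x) + inner ℝ (leviCivitaFun Z x (X x)) (Y x)
  rw [h1, h2, koszul, koszul, mlieBracket_swap_apply (V := Y) (W := X),
    mlieBracket_swap_apply (V := X) (W := Z), mlieBracket_swap_apply (V := Z) (W := Y)]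
  simp_rw [real_inner_comm (X _) (Z _), real_inner_comm (Y _) (Z _), real_inner_comm (Y _) (X _)]
  simp only [inner_neg_left]
  ring

/-- The curvature `R(X, Y)Z = ∇_X ∇_Y Z - ∇_Y ∇_X Z - ∇_[X, Y] Z` of the Levi-Civita connection. -/
def curvature (X Y Z : Π x : M, TangentSpace I x) (x : M) : TangentSpace I x :=
  leviCivita I M (fun y ↦ leviCivita I M Z y (Y y)) x (X x)
    - leviCivita I M (fun y ↦ leviCivita I M Z y (X y)) x (Y x)
    - leviCivita I M Z x (mlieBracket I X Y x)

/-- The Ricci tensor at `x`: `Ric(v, w)` is the trace of `u ↦ R(u, v)w`, computed in an orthonormal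
basis. Tangent vectors at `x` are extended to vector fields that are smooth near `x`. -/
def ricci (x : M) (v w : TangentSpace I x) : ℝ :=
  ∑ i, inner ℝ
    (curvature (extend E (stdOrthonormalBasis ℝ (TangentSpace I x) i)) (extend E v) (extend E w) x)
    (stdOrthonormalBasis ℝ (TangentSpace I x) i)

/-- The Lie derivative of the metric along `X`, at `x`:
`(L_X g)(V, W) = X (g(V, W)) - g([X, V], W) - g(V, [X, W])`, where the tangent vectors at `x` are
extended to vector fields that are smooth near `x`. -/
def lieDerivMetric (X : Π x : M, TangentSpace I x) (x : M) (v w : TangentSpace I x) : ℝ :=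
  mvfderiv I (fun y ↦ inner ℝ (extend E v y : TangentSpace I y) (extend E w y)) x (X x)
    - inner ℝ (mlieBracket I X (extend E v) x) w - inner ℝ v (mlieBracket I X (extend E w) x)

/-- The gradient of a function with respect to the metric. -/
def grad (f : M → ℝ) (x : M) : TangentSpace I x :=
  (InnerProductSpace.toDual ℝ (TangentSpace I x)).symm (mvfderiv I f x)

/-- The Hessian `∇²f(v, w) = g(∇_v ∇f, w)`. -/
def hessian (f : M → ℝ) (x : M) (v w : TangentSpace I x) : ℝ :=
  inner ℝ (leviCivita I M (grad f) x v) w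

/-- The divergence of a vector field: the trace of `v ↦ ∇_v X`. -/
def divergence (X : Π x : M, TangentSpace I x) (x : M) : ℝ :=
  LinearMap.trace ℝ (TangentSpace I x) (leviCivita I M X x).toLinearMap

/-- The `m`-quasi Einstein equation `Ric + ½ L_X g - (1/m) X♭ ⊗ X♭ = lam g` for a smooth vector
field `X`, a constant `lam` and `0 < m ≤ ∞`, where `1/∞ = 0`. -/
structure IsQuasiEinstein (m : ℝ≥0∞) (lam : ℝ) (X : Π x : M, TangentSpace I x) : Prop where
  pos : 0 < m
  smooth : CMDiff ∞ (T% X)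
  eq : ∀ (x : M) (v w : TangentSpace I x),
    ricci x v w + 1 / 2 * lieDerivMetric X x v w
      - (m⁻¹).toReal * (inner ℝ (X x) v * inner ℝ (X x) w) = lam * inner ℝ v w

variable (I) in
/-- The smooth function `f` is a potential function of the `m`-quasi Einstein structure with
constants `m` and `lam`: it satisfies `Ric + ∇²f - (1/m) df ⊗ df = lam g`. -/
structure IsPotentialFunction (m : ℝ≥0∞) (lam : ℝ) (f : M → ℝ) : Prop where
  smooth : CMDiff ∞ f
  eq : ∀ (x : M) (v w : TangentSpace I x),
    ricci x v w + hessian f x v w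
      - (m⁻¹).toReal * (mvfderiv I f x v * mvfderiv I f x w) = lam * inner ℝ v w

/-- The smooth function `ξ` is a Hodge-de Rham potential of `X`: there is a decomposition
`X = W + ∇ξ` with a smooth vector field `W` such that `div W = 0`. -/
structure IsHodgeDeRhamPotential (X : Π x : M, TangentSpace I x) (ξ : M → ℝ) : Prop where
  smooth : CMDiff ∞ ξ
  decomposition : ∃ W : Π x : M, TangentSpace I x, CMDiff ∞ (T% W) ∧
    (∀ x, divergence W x = 0) ∧ ∀ x, X x = W x + grad ξ x

end QuasiEinstein
end

/-!
The potential function `f` is itself a Hodge-de Rham potential of `X`, and any two Hodge-de Rham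
potentials of `X` differ by a constant. No integration is needed: both facts come from looking at
maximum points.

Let `Y = X - ∇f`. Subtracting the two quasi-Einstein equations gives
`½ L_Y g = (1/m) (X♭ ⊗ X♭ - df ⊗ df)` (`IsQuasiEinstein.inner_leviCivita_sub_grad`). If `m = ∞`, its
trace is `div Y = 0`. If `m` is finite, its value on `(Y, Y)` shows that
`exp (-4 f / m) |Y|²` has derivative `(2 / m) exp (-4 f / m) |Y|⁴` along `Y`; this derivative is zero
where the function is largest, so `Y = 0` (`IsQuasiEinstein.eq_grad_of_ne_top`). In both cases
`X = Y + ∇f` with `div Y = 0`.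

If `ξ` and `ξ'` are Hodge-de Rham potentials of `X`, then `div ∇ξ = div X = div ∇ξ'`, so `ξ - ξ'` is
harmonic, and harmonic functions on a compact connected manifold are constant by the strong maximum
principle (`exists_eq_const_of_divergence_grad_nonneg`). The latter is proved with Hopf's barrier
`ε exp (α ψ)` (`exists_eq_max_of_divergence_grad_nonneg`). It rests on the second derivative test
`divergence_grad_nonpos_of_isLocalMax`, which follows from the one-variable test along integral
curves, and on the continuity of the divergence of a smooth field (`continuousAt_divergence`), which
is read off from the Koszul formula in a smooth orthonormal frame.
-/

noncomputable section

namespace QuasiEinstein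

/-! ### Derivatives of functions along vector fields and curves -/

section

variable {E : Type*} [NormedAddCommGroup E] [NormedSpace ℝ E]
  {H : Type*} [TopologicalSpace H] {I : ModelWithCorners ℝ E H}
  {M : Type*} [TopologicalSpace M] [ChartedSpace H M]

theorem contMDiffOn_mvfderiv_apply [IsManifold I ∞ M] {f : M → ℝ}
    {V : Π x : M, TangentSpace I x} {u : Set M} (hu : IsOpen u) (hf : CMDiff[u] ∞ f)
    (hV : CMDiff[u] ∞ (T% V)) :
    CMDiff[u] ∞ (fun y ↦ mvfderiv I f y (V y)) := by
  have h1 := hf.contMDiffOn_tangentMapWithin (m := ∞) le_rfl hu.uniqueMDiffOn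
  have h2 := h1.comp hV (fun y hy ↦ hy)
  have h3 := (contMDiff_snd_tangentBundle_modelSpace ℝ 𝓘(ℝ, ℝ) (n := ∞)).comp_contMDiffOn h2
  refine h3.congr fun y hy ↦ ?_
  change NormedSpace.fromTangentSpace (f y) (mfderiv I 𝓘(ℝ, ℝ) f y (V y)) = _
  rw [← mfderivWithin_of_isOpen hu hy]
  rfl

theorem hasDerivAt_comp_of_hasMFDerivAt {γ : ℝ → M} {w : M → ℝ} {t : ℝ}
    {v : TangentSpace I (γ t)} (hγ : HasMFDerivAt 𝓘(ℝ, ℝ) I γ t ((1 : ℝ →L[ℝ] ℝ).smulRight v))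
    (hw : MDiffAt w (γ t)) : HasDerivAt (w ∘ γ) (mvfderiv I w (γ t) v) t := by
  have h : HasFDerivAt (w ∘ γ)
      ((mvfderiv I w (γ t)).comp ((1 : ℝ →L[ℝ] ℝ).smulRight v : ℝ →L[ℝ] TangentSpace I (γ t))) t :=
    (hw.hasMFDerivAt.comp t hγ).hasFDerivAt
  simpa using h.hasDerivAt

theorem mvfderiv_comp_of_hasDerivAt {φ : ℝ → ℝ} {φ' : ℝ} {ψ : M → ℝ} {x : M}
    (hφ : HasDerivAt φ φ' (ψ x)) (hψ : MDiffAt ψ x) (v : TangentSpace I x) :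
    mvfderiv I (φ ∘ ψ) x v = φ' * mvfderiv I ψ x v := by
  rw [mvfderiv_comp_apply x hφ.differentiableAt.mdifferentiableAt hψ]
  have h : mvfderiv 𝓘(ℝ, ℝ) φ (ψ x) = fderiv ℝ φ (ψ x) := mfderiv_eq_fderiv
  rw [h]
  change fderiv ℝ φ (ψ x) (mvfderiv I ψ x v) = _
  rw [hφ.hasFDerivAt.fderiv]
  simp [mul_comm]

variable [FiniteDimensional ℝ E] [IsManifold I ∞ M] [BoundarylessManifold I M]

theorem exists_isMIntegralCurveAt_extend [T2Space M] (x : M) (v : TangentSpace I x) :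
    ∃ γ : ℝ → M, γ 0 = x ∧ IsMIntegralCurveAt γ (extend E v) 0 := by
  have := FiniteDimensional.complete ℝ E
  exact exists_isMIntegralCurveAt_of_contMDiffAt_boundaryless (t₀ := 0) (I := I)
    (contMDiffAt_extend (k := 1) I E v)

theorem mvfderiv_eq_zero_of_isLocalMax [T2Space M] {w : M → ℝ} {x : M} (hw : MDiffAt w x)
    (hmax : IsLocalMax w x) (v : TangentSpace I x) : mvfderiv I w x v = 0 := by
  obtain ⟨γ, rfl, hγ⟩ := exists_isMIntegralCurveAt_extend x v
  have h := hasDerivAt_comp_of_hasMFDerivAt hγ.hasMFDerivAt hw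
  rw [extend_apply_self] at h
  exact IsLocalMax.hasDerivAt_eq_zero (hmax.comp_tendsto hγ.continuousAt) h

/-- The second derivative test: along an integral curve `γ` of a vector field `V`, the second
derivative of `w ∘ γ` is `V (V w)`. -/
theorem mvfderiv_mvfderiv_extend_nonpos_of_isLocalMax [T2Space M] {w : M → ℝ} {x : M} {u : Set M}
    (hu : IsOpen u) (hx : x ∈ u) (hw : CMDiff[u] ∞ w) (hmax : IsLocalMax w x)
    (v : TangentSpace I x) :
    mvfderiv I (fun y ↦ mvfderiv I w y (extend E v y)) x v ≤ 0 := by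
  obtain ⟨γ, rfl, hγ⟩ := exists_isMIntegralCurveAt_extend x v
  have hd : deriv (w ∘ γ) =ᶠ[𝓝 0] fun t ↦ mvfderiv I w (γ t) (extend E v (γ t)) := by
    filter_upwards [hγ, hγ.continuousAt.preimage_mem_nhds (hu.mem_nhds hx)] with t ht htu
    exact (hasDerivAt_comp_of_hasMFDerivAt ht
      ((hw.contMDiffAt (hu.mem_nhds htu)).mdifferentiableAt (by simp))).deriv
  have hdw : MDiffAt (fun y ↦ mvfderiv I w y (extend E v y)) (γ 0) := by
    obtain ⟨s, hs, hsv⟩ := exists_contMDiffOn_extend (k := ∞) I E v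
    obtain ⟨s', hs's, hs', hxs'⟩ := mem_nhds_iff.1 hs
    exact ((contMDiffOn_mvfderiv_apply (hs'.inter hu) (hw.mono Set.inter_subset_right)
      (hsv.mono (Set.inter_subset_left.trans hs's))).contMDiffAt
      ((hs'.inter hu).mem_nhds ⟨hxs', hx⟩)).mdifferentiableAt (by simp)
  have hdd := hasDerivAt_comp_of_hasMFDerivAt hγ.hasMFDerivAt hdw
  rw [extend_apply_self] at hdd
  have hdd' : deriv (deriv (w ∘ γ)) 0 = mvfderiv I (fun y ↦ mvfderiv I w y (extend E v y)) (γ 0) v :=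
    (hdd.congr_of_eventuallyEq hd).deriv
  have hM : IsLocalMax (w ∘ γ) 0 := hmax.comp_tendsto hγ.continuousAt
  by_contra! hpos
  rw [← hdd'] at hpos
  have hc : ContinuousAt (w ∘ γ) 0 :=
    (hw.contMDiffAt (hu.mem_nhds hx)).continuousAt.comp hγ.continuousAt
  have hm := isLocalMin_of_deriv_deriv_pos hpos hM.deriv_eq_zero hc
  -- A function with a local maximum and a local minimum at the same point is locally constant.
  have hconst : w ∘ γ =ᶠ[𝓝 0] fun _ ↦ (w ∘ γ) 0 := by
    filter_upwards [hM, hm] with t h1 h2 using le_antisymm h1 h2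
  have h0 : deriv (deriv (w ∘ γ)) 0 = 0 := by
    rw [hconst.deriv.deriv_eq]
    simp
  exact hpos.ne' h0

end

/-! ### Smooth orthonormal frames and gradients -/

/-- An orthonormal family whose cardinality is the dimension, as an orthonormal basis. Unlike
`basisOfOrthonormalOfCardEqFinrank` this does not exclude dimension zero. -/
def _root_.Orthonormal.toOrthonormalBasis {V ι : Type*} [NormedAddCommGroup V]
    [InnerProductSpace ℝ V] [FiniteDimensional ℝ V] [Fintype ι] {v : ι → V} (hv : Orthonormal ℝ v)
    (hcard : Fintype.card ι = Module.finrank ℝ V) : OrthonormalBasis ι ℝ V :=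
  OrthonormalBasis.mk hv (hv.linearIndependent.span_eq_top_of_card_eq_finrank' hcard).ge

@[simp]
theorem _root_.Orthonormal.coe_toOrthonormalBasis {V ι : Type*} [NormedAddCommGroup V]
    [InnerProductSpace ℝ V] [FiniteDimensional ℝ V] [Fintype ι] {v : ι → V} (hv : Orthonormal ℝ v)
    (hcard : Fintype.card ι = Module.finrank ℝ V) : ⇑(hv.toOrthonormalBasis hcard) = v := by
  simp [Orthonormal.toOrthonormalBasis]

variable {E : Type*} [NormedAddCommGroup E] [NormedSpace ℝ E]
  {H : Type*} [TopologicalSpace H] {I : ModelWithCorners ℝ E H}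
  {M : Type*} [TopologicalSpace M] [ChartedSpace H M]

theorem card_fin_finrank_tangentSpace (x : M) :
    Fintype.card (Fin (Module.finrank ℝ E)) = Module.finrank ℝ (TangentSpace I x) :=
  Fintype.card_fin _

variable [RiemannianBundle (fun x : M ↦ TangentSpace I x)]

section

variable [IsManifold I ∞ M] [IsContMDiffRiemannianBundle I ∞ E (fun x : M ↦ TangentSpace I x)]

theorem contMDiffOn_inner {n : ℕ∞} {X Y : Π x : M, TangentSpace I x} {u : Set M}
    (hX : CMDiff[u] n (T% X)) (hY : CMDiff[u] n (T% Y)) :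
    CMDiff[u] n (fun y ↦ (inner ℝ (X y) (Y y) : ℝ)) :=
  have : IsContMDiffRiemannianBundle I n E (fun x : M ↦ TangentSpace I x) :=
    IsContMDiffRiemannianBundle.of_le (n := ∞) (by exact_mod_cast le_top)
  ContMDiffOn.inner_bundle (E := fun x : M ↦ TangentSpace I x) (F := E) (b := id) hX hY

theorem contMDiffAt_inner {n : ℕ∞} {X Y : Π x : M, TangentSpace I x} {x : M}
    (hX : CMDiffAt n (T% X) x) (hY : CMDiffAt n (T% Y) x) :
    CMDiffAt n (fun y ↦ (inner ℝ (X y) (Y y) : ℝ)) x :=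
  have : IsContMDiffRiemannianBundle I n E (fun x : M ↦ TangentSpace I x) :=
    IsContMDiffRiemannianBundle.of_le (n := ∞) (by exact_mod_cast le_top)
  ContMDiffAt.inner_bundle (E := fun x : M ↦ TangentSpace I x) (F := E) (b := id) hX hY

/-- The Gram-Schmidt process turns a smooth frame into a smooth orthogonal one: each step divides
only by the squared norm of a nonvanishing vector field. -/
theorem contMDiffOn_gramSchmidt {ι : Type*} [LinearOrder ι] [LocallyFiniteOrderBot ι]
    [WellFoundedLT ι] {s : ι → Π x : M, TangentSpace I x} {u : Set M}
    (hs : ∀ i, CMDiff[u] ∞ (T% (s i))) (hlin : ∀ y ∈ u, LinearIndependent ℝ fun i ↦ s i y) (i : ι) :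
    CMDiff[u] ∞ (T% fun y ↦ InnerProductSpace.gramSchmidt ℝ (fun i ↦ s i y) i) := by
  induction i using WellFoundedLT.induction with
  | ind i ih =>
    have key : ∀ y, InnerProductSpace.gramSchmidt ℝ (fun i ↦ s i y) i = s i y - ∑ j ∈ Finset.Iio i,
        (inner ℝ (InnerProductSpace.gramSchmidt ℝ (fun i ↦ s i y) j) (s i y) /
          inner ℝ (InnerProductSpace.gramSchmidt ℝ (fun i ↦ s i y) j)
            (InnerProductSpace.gramSchmidt ℝ (fun i ↦ s i y) j)) •
            InnerProductSpace.gramSchmidt ℝ (fun i ↦ s i y) j := fun y ↦ by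
      rw [eq_sub_iff_add_eq]
      simp only [real_inner_self_eq_norm_sq]
      exact (InnerProductSpace.gramSchmidt_def'' ℝ (fun i ↦ s i y) i).symm
    simp_rw [key]
    refine (hs i).sub_section (ContMDiffOn.sum_section fun j hj ↦ ?_)
    have hj := ih j (Finset.mem_Iio.1 hj)
    refine ContMDiffOn.smul_section (ContMDiffOn.div₀ (contMDiffOn_inner hj (hs i))
      (contMDiffOn_inner hj hj) fun y hy ↦ ?_) hj
    exact inner_self_ne_zero.2 (InnerProductSpace.gramSchmidt_ne_zero _ (hlin y hy))

end

variable [FiniteDimensional ℝ E]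

theorem inner_grad (f : M → ℝ) (x : M) (v : TangentSpace I x) :
    inner ℝ (grad f x) v = mvfderiv I f x v := by
  simp [grad]

theorem grad_add {f f' : M → ℝ} {x : M} (hf : MDiffAt f x) (hf' : MDiffAt f' x) :
    (grad (f + f') x : TangentSpace I x) = grad f x + grad f' x := by
  refine ext_inner_right ℝ fun v ↦ ?_
  rw [inner_add_left, inner_grad, inner_grad, inner_grad, mvfderiv_add hf hf']
  rfl

theorem grad_comp_of_hasDerivAt {φ : ℝ → ℝ} {φ' : ℝ} {ψ : M → ℝ} {x : M}
    (hφ : HasDerivAt φ φ' (ψ x)) (hψ : MDiffAt ψ x) :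
    (grad (φ ∘ ψ) x : TangentSpace I x) = φ' • grad ψ x := by
  refine ext_inner_right ℝ fun v ↦ ?_
  rw [real_inner_smul_left, inner_grad, inner_grad, mvfderiv_comp_of_hasDerivAt hφ hψ]

variable [IsManifold I ∞ M] [IsContMDiffRiemannianBundle I ∞ E (fun x : M ↦ TangentSpace I x)]

theorem exists_contMDiffOn_orthonormal_frame (p : M) :
    ∃ u : Set M, IsOpen u ∧ p ∈ u ∧
      ∃ e : Fin (Module.finrank ℝ E) → Π x : M, TangentSpace I x,
        (∀ i, CMDiff[u] ∞ (T% (e i))) ∧ ∀ y ∈ u, Orthonormal ℝ fun i ↦ e i y := by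
  set t := trivializationAt E (TangentSpace I : M → Type _) p
  have hfr := t.isLocalFrameOn_localFrame_baseSet I ∞ (Module.finBasis ℝ E)
  set s := t.localFrame (Module.finBasis ℝ E)
  have hlin : ∀ y ∈ t.baseSet, LinearIndependent ℝ fun i ↦ s i y := fun y hy ↦
    hfr.linearIndependent hy
  refine ⟨t.baseSet, t.open_baseSet, mem_baseSet_trivializationAt' p,
    fun i y ↦ InnerProductSpace.gramSchmidtNormed ℝ (fun i ↦ s i y) i, fun i ↦ ?_, fun y hy ↦
      InnerProductSpace.gramSchmidtNormed_orthonormal (hlin y hy)⟩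
  have h := contMDiffOn_gramSchmidt hfr.contMDiffOn hlin i
  refine ContMDiffOn.smul_section ?_ h
  have h2 := contMDiffOn_inner h h
  have h0 : ∀ y ∈ t.baseSet, InnerProductSpace.gramSchmidt ℝ (fun i ↦ s i y) i ≠ 0 := fun y hy ↦
    InnerProductSpace.gramSchmidt_ne_zero _ (hlin y hy)
  refine ContMDiffOn.inv₀ ?_ fun y hy ↦ by simpa using h0 y hy
  intro y hy
  have h3 := Real.contDiffAt_sqrt (n := ∞) (inner_self_ne_zero (𝕜 := ℝ).2 (h0 y hy))
  refine (h3.contMDiffAt.comp_contMDiffWithinAt y (h2 y hy)).congr ?_ ?_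
  · intro z hz
    simp
  · simp

/-- In a smooth orthonormal frame `e` the gradient is `∑ i, df (e i) • e i`. -/
theorem contMDiffOn_grad {f : M → ℝ} {u : Set M} (hu : IsOpen u) (hf : CMDiff[u] ∞ f) :
    CMDiff[u] ∞ (T% (fun x ↦ (grad f x : TangentSpace I x))) := by
  intro p hp
  obtain ⟨v, hv, hpv, e, he, hon⟩ := exists_contMDiffOn_orthonormal_frame (I := I) p
  have hvu : v ∩ u ∈ 𝓝 p := (hv.inter hu).mem_nhds ⟨hpv, hp⟩
  have key : CMDiff[v ∩ u] ∞ (T% (fun x ↦ (∑ i, mvfderiv I f x (e i x) • e i x))) :=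
    ContMDiffOn.sum_section fun i _ ↦ ContMDiffOn.smul_section
      (contMDiffOn_mvfderiv_apply (hv.inter hu) (hf.mono Set.inter_subset_right)
        ((he i).mono Set.inter_subset_left)) ((he i).mono Set.inter_subset_left)
  refine (((key p ⟨hpv, hp⟩).contMDiffAt hvu).congr_of_eventuallyEq ?_).contMDiffWithinAt
  filter_upwards [hvu] with y hy
  congr 1
  let b := (hon y hy.1).toOrthonormalBasis (card_fin_finrank_tangentSpace _)
  rw [← b.sum_repr' (grad f y)]
  refine Finset.sum_congr rfl fun i _ ↦ ?_
  rw [real_inner_comm, inner_grad]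
  simp [b]

theorem contMDiff_grad {f : M → ℝ} (hf : CMDiff ∞ f) :
    CMDiff ∞ (T% fun x ↦ (grad f x : TangentSpace I x)) :=
  contMDiffOn_univ.1 (contMDiffOn_grad isOpen_univ hf.contMDiffOn)

theorem mdiffAt_grad {f : M → ℝ} {u : Set M} {x : M} (hu : IsOpen u) (hx : x ∈ u)
    (hf : CMDiff[u] ∞ f) : MDiffAt (T% fun y ↦ (grad f y : TangentSpace I y)) x :=
  ((contMDiffOn_grad hu hf).contMDiffAt (hu.mem_nhds hx)).mdifferentiableAt (by simp)

/-! ### The divergence of a vector field -/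

theorem divergence_eq_sum_inner {ι : Type*} [Fintype ι] {x : M}
    (b : OrthonormalBasis ι ℝ (TangentSpace I x)) (X : Π x : M, TangentSpace I x) :
    divergence X x = ∑ i, inner ℝ (leviCivita I M X x (b i)) (b i) := by
  rw [divergence, LinearMap.trace_eq_sum_inner _ b]
  simp [real_inner_comm]

theorem divergence_add {X Y : Π x : M, TangentSpace I x} {x : M}
    (hX : MDiffAt (T% X) x) (hY : MDiffAt (T% Y) x) :
    divergence (X + Y) x = divergence X x + divergence Y x := by
  have h : leviCivita I M (X + Y) x = leviCivita I M X x + leviCivita I M Y x :=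
    (leviCivita I M).isCovariantDerivativeOnUniv.add hX hY
  rw [divergence, h]
  simp [divergence]

theorem divergence_smul {φ : M → ℝ} {X : Π x : M, TangentSpace I x} {x : M}
    (hφ : MDiffAt φ x) (hX : MDiffAt (T% X) x) :
    divergence (φ • X) x = φ x * divergence X x + mvfderiv I φ x (X x) := by
  have h := (leviCivita I M).isCovariantDerivativeOnUniv.leibniz hX hφ (Set.mem_univ x)
  have h2 : leviCivita I M (φ • X) x
      = φ x • leviCivita I M X x + (mvfderiv I φ x).smulRight (X x) := h
  have h3 : ((mvfderiv I φ x).smulRight (X x)).toLinearMap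
      = (mvfderiv I φ x).toLinearMap.smulRight (X x) := rfl
  rw [divergence, h2]
  simp only [ContinuousLinearMap.toLinearMap_add,
    ContinuousLinearMap.toLinearMap_smul, map_add, map_smul, h3,
    LinearMap.trace_smulRight]
  rfl

theorem divergence_congr [T2Space M] {X Y : Π x : M, TangentSpace I x} {x : M}
    (hX : MDiffAt (T% X) x) (hY : MDiffAt (T% Y) x) (h : ∀ᶠ y in 𝓝 x, X y = Y y) :
    divergence X x = divergence Y x := by
  rw [divergence, divergence, (leviCivita I M).isCovariantDerivativeOnUniv.congr_of_eventuallyEq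
    hX hY Filter.univ_mem h]

/-- In an orthonormal frame `e` the Koszul formula reduces the divergence of `X` to Lie brackets. -/
theorem divergence_eq_sum_inner_mlieBracket {u : Set M} (hu : IsOpen u)
    {e : Fin (Module.finrank ℝ E) → Π x : M, TangentSpace I x}
    (he : ∀ i, CMDiff[u] ∞ (T% (e i))) (hon : ∀ y ∈ u, Orthonormal ℝ fun i ↦ e i y)
    {X : Π x : M, TangentSpace I x} {x : M} (hx : x ∈ u) (hX : MDiffAt (T% X) x) :
    divergence X x = ∑ i, inner ℝ (mlieBracket I (e i) X x) (e i x) := by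
  rw [divergence_eq_sum_inner ((hon x hx).toOrthonormalBasis (card_fin_finrank_tangentSpace _))]
  refine Finset.sum_congr rfl fun i _ ↦ ?_
  have hei : MDiffAt (T% (e i)) x :=
    ((he i).contMDiffAt (hu.mem_nhds hx)).mdifferentiableAt (by simp)
  have hone : (fun y ↦ (inner ℝ (e i y) (e i y) : ℝ)) =ᶠ[𝓝 x] fun _ ↦ 1 := by
    filter_upwards [hu.mem_nhds hx] with y hy
    simp [(hon y hy).1 i]
  have hd : mvfderiv I (fun y ↦ (inner ℝ (e i y) (e i y) : ℝ)) x (X x) = 0 := by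
    change (mfderiv I 𝓘(ℝ, ℝ) _ x (X x) : ℝ) = 0
    rw [hone.mfderiv_eq, mfderiv_const]
    rfl
  have h := inner_leviCivitaFun_field hei hX hei
  simp only [Orthonormal.coe_toOrthonormalBasis]
  change inner ℝ (leviCivitaFun X x (e i x)) (e i x) = _
  rw [h, koszul, hd, mlieBracket_swap_apply (V := X) (W := e i)]
  simp_rw [real_inner_comm (X _) (e i _)]
  simp
  ring

/-- Local boundedness of the Laplacian of a smooth function, needed for the barrier in the maximum
principle, comes from this. -/
theorem continuousAt_divergence {u : Set M} (hu : IsOpen u) {X : Π x : M, TangentSpace I x}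
    (hX : CMDiff[u] ∞ (T% X)) {p : M} (hp : p ∈ u) : ContinuousAt (divergence X) p := by
  obtain ⟨v, hv, hpv, e, he, hon⟩ := exists_contMDiffOn_orthonormal_frame (I := I) p
  have hvu : v ∩ u ∈ 𝓝 p := (hv.inter hu).mem_nhds ⟨hpv, hp⟩
  have key : ContinuousAt (fun y ↦ ∑ i, (inner ℝ (mlieBracket I (e i) X y) (e i y) : ℝ)) p := by
    refine tendsto_finsetSum _ fun i _ ↦ ?_
    have hei : CMDiffAt 1 (T% (e i)) p :=
      ((he i).contMDiffAt (hv.mem_nhds hpv)).of_le (by simp)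
    have hXp : CMDiffAt 1 (T% X) p := (hX.contMDiffAt (hu.mem_nhds hp)).of_le (by simp)
    have : IsManifold I ((1 : ℕ∞) + 1) M := IsManifold.of_le (n := ∞) (by exact_mod_cast le_top)
    have : IsManifold I (minSmoothness ℝ 2) M := by
      rw [minSmoothness_of_isRCLikeNormedField]
      infer_instance
    have hb : CMDiffAt (0 : ℕ∞) (T% (mlieBracket I (e i) X)) p :=
      ContMDiffAt.mlieBracket_vectorField (m := 0) (n := 1) hei hXp (by simp)
    exact (contMDiffAt_inner hb (hei.of_le (by simp))).continuousAt
  refine key.congr ?_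
  filter_upwards [hvu] with y hy
  exact (divergence_eq_sum_inner_mlieBracket hv he hon hy.1
    ((hX.contMDiffAt (hu.mem_nhds hy.2)).mdifferentiableAt (by simp))).symm

theorem leviCivita_sub {X Y : Π x : M, TangentSpace I x} {x : M}
    (hX : MDiffAt (T% X) x) (hY : MDiffAt (T% Y) x) :
    leviCivita I M (X - Y) x = leviCivita I M X x - leviCivita I M Y x := by
  have h : leviCivita I M (X - Y + Y) x = leviCivita I M (X - Y) x + leviCivita I M Y x :=
    (leviCivita I M).isCovariantDerivativeOnUniv.add (mdifferentiableAt_sub_section hX hY) hY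
  rw [sub_add_cancel] at h
  rw [h, add_sub_cancel_right]

theorem divergence_sub {X Y : Π x : M, TangentSpace I x} {x : M}
    (hX : MDiffAt (T% X) x) (hY : MDiffAt (T% Y) x) :
    divergence (X - Y) x = divergence X x - divergence Y x := by
  rw [divergence, leviCivita_sub hX hY]
  simp [divergence]

theorem divergence_grad_add [T2Space M] {f f' : M → ℝ} {u : Set M} {x : M} (hu : IsOpen u)
    (hx : x ∈ u) (hf : CMDiff[u] ∞ f) (hf' : CMDiff[u] ∞ f') :
    divergence (fun y ↦ (grad (f + f') y : TangentSpace I y)) x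
      = divergence (fun y ↦ (grad f y : TangentSpace I y)) x
        + divergence (fun y ↦ (grad f' y : TangentSpace I y)) x := by
  have h1 := mdiffAt_grad (I := I) hu hx hf
  have h2 := mdiffAt_grad (I := I) hu hx hf'
  rw [← divergence_add h1 h2]
  refine divergence_congr (mdiffAt_grad hu hx (hf.add hf')) (mdifferentiableAt_add_section h1 h2) ?_
  filter_upwards [hu.mem_nhds hx] with y hy
  exact grad_add ((hf.contMDiffAt (hu.mem_nhds hy)).mdifferentiableAt (by simp))
    ((hf'.contMDiffAt (hu.mem_nhds hy)).mdifferentiableAt (by simp))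

/-- The Laplacian of `ε exp (α ψ)`. For large `α` the term quadratic in `∇ψ` dominates. -/
theorem divergence_grad_const_mul_exp [T2Space M] {ψ : M → ℝ} {u : Set M} {x : M} (hu : IsOpen u)
    (hx : x ∈ u) (hψ : CMDiff[u] ∞ ψ) (ε α : ℝ) :
    divergence (fun y ↦ (grad ((fun s ↦ ε * Real.exp (α * s)) ∘ ψ) y : TangentSpace I y)) x
      = ε * α * Real.exp (α * ψ x) * (divergence (fun y ↦ (grad ψ y : TangentSpace I y)) x
        + α * inner ℝ (grad ψ x : TangentSpace I x) (grad ψ x)) := by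
  have hd : ∀ a s : ℝ, HasDerivAt (fun s ↦ a * Real.exp (α * s)) (a * α * Real.exp (α * s)) s :=
    fun a s ↦ ((((hasDerivAt_id s).const_mul α).exp).const_mul a).congr_deriv (by simp; ring)
  have hψd : ∀ y ∈ u, MDiffAt ψ y := fun y hy ↦
    (hψ.contMDiffAt (hu.mem_nhds hy)).mdifferentiableAt (by simp)
  have h1 := mdiffAt_grad (I := I) hu hx hψ
  have h2 : MDiffAt ((fun s ↦ ε * α * Real.exp (α * s)) ∘ ψ) x :=
    (hd _ _).differentiableAt.mdifferentiableAt.comp x (hψd x hx)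
  have hs : CMDiff[u] ∞ ((fun s ↦ ε * Real.exp (α * s)) ∘ ψ) :=
    ContMDiff.comp_contMDiffOn (g := fun s ↦ ε * Real.exp (α * s))
      (ContDiff.contMDiff (by fun_prop)) hψ
  rw [divergence_congr (Y := ((fun s ↦ ε * α * Real.exp (α * s)) ∘ ψ) •
      fun y ↦ (grad ψ y : TangentSpace I y)) (mdiffAt_grad hu hx hs) (h2.smul_section h1),
    divergence_smul h2 h1, mvfderiv_comp_of_hasDerivAt (hd _ _) (hψd x hx), inner_grad]
  · simp only [Function.comp_apply]
    ring
  · filter_upwards [hu.mem_nhds hx] with y hy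
    exact grad_comp_of_hasDerivAt (hd _ _) (hψd y hy)

/-! ### The strong maximum principle -/

/-- At a local maximum `∇w` vanishes, so that each diagonal entry `⟨∇_v ∇w, v⟩` of the Hessian is
the second derivative `V (V w)` for any extension `V` of `v`. -/
theorem divergence_grad_nonpos_of_isLocalMax [T2Space M] [BoundarylessManifold I M]
    {w : M → ℝ} {x : M} {u : Set M} (hu : IsOpen u) (hx : x ∈ u) (hw : CMDiff[u] ∞ w)
    (hmax : IsLocalMax w x) :
    divergence (fun y ↦ (grad w y : TangentSpace I y)) x ≤ 0 := by
  have hgrad : MDiffAt (T% fun y ↦ (grad w y : TangentSpace I y)) x :=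
    ((contMDiffOn_grad hu hw).contMDiffAt (hu.mem_nhds hx)).mdifferentiableAt (by simp)
  have hwx : MDiffAt w x := (hw.contMDiffAt (hu.mem_nhds hx)).mdifferentiableAt (by simp)
  have hzero : (grad w x : TangentSpace I x) = 0 := ext_inner_right ℝ fun v ↦ by
    rw [inner_grad, mvfderiv_eq_zero_of_isLocalMax hwx hmax, inner_zero_left]
  rw [divergence_eq_sum_inner (stdOrthonormalBasis ℝ (TangentSpace I x))]
  refine Finset.sum_nonpos fun i _ ↦ ?_
  set v := stdOrthonormalBasis ℝ (TangentSpace I x) i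
  have hv := mdifferentiableAt_extend I E v
  have h := mvfderiv_inner_eq hv hgrad hv
  simp only [extend_apply_self, hzero, inner_zero_left, add_zero, inner_grad] at h
  rw [← h]
  exact mvfderiv_mvfderiv_extend_nonpos_of_isLocalMax hu hx hw hmax v

/-- Hopf's barrier argument. Let the subharmonic function `h` attain its maximum at `y`, and let `ψ`
vanish at `y` with nonzero gradient. Then `{ψ ≥ 0}` cannot touch the set of maximum points of `h` at
`y` only: otherwise, for large `α` and small `ε`, the function `h + ε exp (α ψ)` is strictly
subharmonic near `y` and has an interior local maximum there. -/
theorem exists_eq_max_of_divergence_grad_nonneg [T2Space M] [CompactSpace M]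
    [BoundarylessManifold I M] {h ψ : M → ℝ} {u : Set M} {y : M}
    (hh : CMDiff ∞ h) (hsub : ∀ x, 0 ≤ divergence (fun y ↦ (grad h y : TangentSpace I y)) x)
    (hle : ∀ x, h x ≤ h y)
    (hu : IsOpen u) (hy : y ∈ u) (hψ : CMDiff[u] ∞ ψ) (hψy : ψ y = 0)
    (hgrad : (grad ψ y : TangentSpace I y) ≠ 0) :
    ∃ x ∈ u, x ≠ y ∧ 0 ≤ ψ x ∧ h x = h y := by
  by_contra! htouch
  set D := divergence (fun x ↦ (grad ψ x : TangentSpace I x)) with hD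
  set N : M → ℝ := fun x ↦ inner ℝ (grad ψ x : TangentSpace I x) (grad ψ x) with hN
  have hNy : 0 < N y := real_inner_self_pos.2 hgrad
  obtain ⟨α, hα, hαD⟩ : ∃ α : ℝ, 0 < α ∧ 0 < D y + α * N y := by
    refine ⟨(|D y| + 1) / N y, by positivity, ?_⟩
    rw [div_mul_cancel₀ _ hNy.ne']
    linarith [neg_abs_le (D y)]
  have hgs := contMDiffOn_grad (I := I) hu hψ
  have hcont : ContinuousAt (fun x ↦ D x + α * N x) y :=
    (continuousAt_divergence hu hgs hy).add
      (((contMDiffOn_inner hgs hgs).contMDiffAt (hu.mem_nhds hy)).continuousAt.const_mul α)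
  obtain ⟨K, hKy, hKs, hK⟩ := local_compact_nhds
    (Filter.inter_mem (hu.mem_nhds hy) (hcont.eventually (lt_mem_nhds hαD)))
  have hKu : K ⊆ u := fun x hx ↦ (hKs hx).1
  have hψK : ContinuousOn ψ K := hψ.continuousOn.mono hKu
  -- On the part of the boundary of `K` where `ψ ≥ 0` the function `h` stays away from its maximum.
  obtain ⟨η, hη, hηh⟩ : ∃ η : ℝ, 0 < η ∧ ∀ x ∈ K \ interior K, 0 ≤ ψ x → h x ≤ h y - η := by
    have hB : IsCompact ((K ∩ ψ ⁻¹' Set.Ici 0) \ interior K) :=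
      (hK.of_isClosed_subset (hψK.preimage_isClosed_of_isClosed hK.isClosed isClosed_Ici)
        Set.inter_subset_left).diff isOpen_interior
    rcases ((K ∩ ψ ⁻¹' Set.Ici 0) \ interior K).eq_empty_or_nonempty with he | hne
    · refine ⟨1, one_pos, fun x hx hx0 ↦ ?_⟩
      exact absurd (show x ∈ (K ∩ ψ ⁻¹' Set.Ici 0) \ interior K from ⟨⟨hx.1, hx0⟩, hx.2⟩)
        (by simp [he])
    · obtain ⟨b, hb, hmax⟩ := hB.exists_isMaxOn hne hh.continuous.continuousOn
      have hby : b ≠ y := fun e ↦ hb.2 (e ▸ mem_interior_iff_mem_nhds.2 hKy)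
      have hlt : h b < h y := lt_of_le_of_ne (hle b) (htouch b (hKu hb.1.1) hby hb.1.2)
      refine ⟨h y - h b, sub_pos.2 hlt, fun x hx hx0 ↦ ?_⟩
      have := hmax (show x ∈ (K ∩ ψ ⁻¹' Set.Ici 0) \ interior K from ⟨⟨hx.1, hx0⟩, hx.2⟩)
      simp only [Set.mem_ofPred_eq] at this
      linarith
  -- `ε` is so small that the barrier cannot make up for the gap `η`.
  obtain ⟨C, hC⟩ := hK.exists_bound_of_continuousOn
    (f := fun x ↦ Real.exp (α * ψ x)) (by fun_prop)
  have hC0 : 0 < C := lt_of_lt_of_le (by simp [Real.exp_pos]) (hC y (mem_of_mem_nhds hKy))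
  set ε := η / C with hε
  have hε0 : 0 < ε := by positivity
  have hεC : ε * C = η := div_mul_cancel₀ _ hC0.ne'
  set w : M → ℝ := h + (fun s ↦ ε * Real.exp (α * s)) ∘ ψ with hw
  have hsm : CMDiff[u] ∞ ((fun s ↦ ε * Real.exp (α * s)) ∘ ψ) :=
    ContMDiff.comp_contMDiffOn (g := fun s ↦ ε * Real.exp (α * s))
      (ContDiff.contMDiff (by fun_prop)) hψ
  have hwu : CMDiff[u] ∞ w := hh.contMDiffOn.add hsm
  obtain ⟨q, hqK, hqmax⟩ := hK.exists_isMaxOn ⟨y, mem_of_mem_nhds hKy⟩ (hwu.continuousOn.mono hKu)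
  have hwy : w y = h y + ε := by simp [hw, hψy]
  have hyq : h y + ε ≤ w q := hwy ▸ hqmax (mem_of_mem_nhds hKy)
  have hwq : w q = h q + ε * Real.exp (α * ψ q) := rfl
  -- On the boundary of `K`, `w` stays below `w y`: by the choice of `ε` where `ψ ≥ 0`, and because
  -- the barrier is smaller than at `y` where `ψ < 0`.
  have hqi : q ∈ interior K := by
    by_contra hq
    rcases le_or_gt 0 (ψ q) with h0 | h0
    · have h1 := hηh q ⟨hqK, hq⟩ h0
      have h2 : Real.exp (α * ψ q) ≤ C := le_trans (le_abs_self _) (hC q hqK)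
      have h3 := mul_le_mul_of_nonneg_left h2 hε0.le
      linarith
    · have h1 : Real.exp (α * ψ q) < 1 := Real.exp_lt_one_iff.2 (mul_neg_of_pos_of_neg hα h0)
      have h3 := mul_lt_mul_of_pos_left h1 hε0
      linarith [hle q]
  have hlm : IsLocalMax w q := hqmax.isLocalMax (mem_interior_iff_mem_nhds.1 hqi)
  have hle0 := divergence_grad_nonpos_of_isLocalMax (I := I) hu (hKu hqK) hwu hlm
  rw [divergence_grad_add hu (hKu hqK) hh.contMDiffOn hsm,
    divergence_grad_const_mul_exp hu (hKu hqK) hψ] at hle0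
  have hpos : 0 < D q + α * N q := (hKs hqK).2
  have : 0 < ε * α * Real.exp (α * ψ q) * (D q + α * N q) := by positivity
  linarith [hsub q]

section StrongMaximumPrinciple

variable {E : Type*} [NormedAddCommGroup E] [InnerProductSpace ℝ E] [FiniteDimensional ℝ E]
  {H : Type*} [TopologicalSpace H] {I : ModelWithCorners ℝ E H} [I.Boundaryless]
  {M : Type*} [TopologicalSpace M] [ChartedSpace H M]
  [IsManifold I ∞ M] [RiemannianBundle (fun x : M ↦ TangentSpace I x)]

/-- The barrier function attached to the sphere in a chart with center `z` that passes through `a`.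
Because of the term `‖φ x - a‖²`, whose derivative vanishes at `a`, it is negative outside the open
ball except at `a`. -/
theorem grad_sub_sq_norm_extChartAt_ne_zero {p : M} {z a : E}
    (ha : a ∈ (extChartAt I p).target) (haz : a ≠ z) :
    (grad (fun x ↦ dist a z ^ 2 - ‖extChartAt I p x - z‖ ^ 2 - ‖extChartAt I p x - a‖ ^ 2)
      ((extChartAt I p).symm a) : TangentSpace I ((extChartAt I p).symm a)) ≠ 0 := by
  intro h0
  set φ := extChartAt I p
  set ψ : M → ℝ := fun x ↦ dist a z ^ 2 - ‖φ x - z‖ ^ 2 - ‖φ x - a‖ ^ 2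
  have hsymm : MDifferentiableAt 𝓘(ℝ, E) I φ.symm a :=
    ((contMDiffOn_extChartAt_symm (n := ∞) p).contMDiffAt
      ((isOpen_extChartAt_target p).mem_nhds ha)).mdifferentiableAt (by simp)
  have hψ : MDiffAt ψ (φ.symm a) := by
    have h1 : MDifferentiableAt I 𝓘(ℝ, E) φ (φ.symm a) :=
      mdifferentiableAt_extChartAt (by simpa [φ] using φ.map_target ha)
    have h2 : Differentiable ℝ fun b : E ↦ dist a z ^ 2 - ‖b - z‖ ^ 2 - ‖b - a‖ ^ 2 :=
      ((differentiable_const _).sub ((differentiable_id.sub_const z).norm_sq ℝ)).sub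
        ((differentiable_id.sub_const a).norm_sq ℝ)
    exact (h2 _).mdifferentiableAt.comp _ h1
  have hcomp := mvfderiv_comp_apply a hψ hsymm (z - a)
  rw [← inner_grad, h0, inner_zero_left] at hcomp
  have hev : ψ ∘ φ.symm =ᶠ[𝓝 a] fun b ↦ dist a z ^ 2 - ‖b - z‖ ^ 2 - ‖b - a‖ ^ 2 := by
    filter_upwards [(isOpen_extChartAt_target p).mem_nhds ha] with b hb
    simp [ψ, φ.right_inv hb]
  have hd : HasFDerivAt (fun b : E ↦ dist a z ^ 2 - ‖b - z‖ ^ 2 - ‖b - a‖ ^ 2) _ a :=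
    ((hasFDerivAt_const _ _).sub ((hasFDerivAt_id a).sub_const z).norm_sq).sub
      ((hasFDerivAt_id a).sub_const a).norm_sq
  have hfd : mvfderiv 𝓘(ℝ, E) (ψ ∘ φ.symm) a = fderiv ℝ (ψ ∘ φ.symm) a := mfderiv_eq_fderiv
  have h1 : fderiv ℝ (ψ ∘ φ.symm) a (z - a) = 0 := by
    rw [← hfd]
    exact hcomp
  rw [hev.fderiv_eq, hd.fderiv] at h1
  have h2 : inner ℝ (a - z) (z - a) = 0 := by simpa [← inner_sub_left] using h1
  rw [← neg_sub a z, inner_neg_right, neg_eq_zero, inner_self_eq_zero, sub_eq_zero] at h2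
  exact haz h2

variable [T2Space M] [CompactSpace M]
  [IsContMDiffRiemannianBundle I ∞ E (fun x : M ↦ TangentSpace I x)]

/-- If some point `x` near the maximum point `p` had `h x < h p`, the largest ball around `x` in a
chart at `p` that is free of maximum points would have a maximum point `a` on its boundary, where the
barrier argument gives a contradiction. -/
theorem eventually_eq_max_of_divergence_grad_nonneg {h : M → ℝ} {p : M}
    (hh : CMDiff ∞ h) (hsub : ∀ x, 0 ≤ divergence (fun y ↦ (grad h y : TangentSpace I y)) x)
    (hle : ∀ x, h x ≤ h p) : ∀ᶠ x in 𝓝 p, h x = h p := by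
  set φ := extChartAt I p
  -- The factor 2 leaves room for the ball around `z` below, of radius less than `r`.
  obtain ⟨r, hr, hrφ⟩ : ∃ r > 0, Metric.closedBall (φ p) (2 * r) ⊆ φ.target := by
    obtain ⟨s, hs, hsφ⟩ := Metric.nhds_basis_closedBall.mem_iff.1
      (extChartAt_target_mem_nhds (I := I) p)
    exact ⟨s / 2, by positivity, by rwa [mul_div_cancel₀ s two_ne_zero]⟩
  have hball : φ ⁻¹' Metric.ball (φ p) r ∩ φ.source ∈ 𝓝 p :=
    Filter.inter_mem ((continuousAt_extChartAt p).preimage_mem_nhds (Metric.ball_mem_nhds _ hr))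
      (extChartAt_source_mem_nhds p)
  filter_upwards [hball] with x ⟨hxr, hxs⟩
  by_contra hxm
  set z := φ x
  -- `a` is a maximum point in the chart that is nearest to `z`.
  have hS : IsCompact (Metric.closedBall (φ p) (2 * r) ∩ φ.symm ⁻¹' {x | h x = h p}) :=
    (isCompact_closedBall _ _).of_isClosed_subset
      (((continuousOn_extChartAt_symm p).mono hrφ).preimage_isClosed_of_isClosed
        Metric.isClosed_closedBall (isClosed_eq hh.continuous continuous_const))
      Set.inter_subset_left
  have hpS : φ p ∈ Metric.closedBall (φ p) (2 * r) ∩ φ.symm ⁻¹' {x | h x = h p} :=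
    ⟨Metric.mem_closedBall_self (by positivity), by simp [φ]⟩
  obtain ⟨a, ⟨haB, hah⟩, hmin⟩ := hS.exists_isMinOn ⟨_, hpS⟩
    (continuous_id.dist continuous_const : Continuous fun b ↦ dist b z).continuousOn
  have hah : h (φ.symm a) = h p := hah
  have hazr : dist a z < r := lt_of_le_of_lt (hmin hpS) (by simpa [dist_comm] using hxr)
  have haz : a ≠ z := by
    rintro rfl
    exact hxm (by rw [← hah, φ.left_inv hxs])
  have hap : dist a (φ p) < 2 * r := by
    have h1 := dist_triangle a z (φ p)
    have h2 : dist z (φ p) < r := hxr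
    linarith
  have haφ : a ∈ φ.target := hrφ haB
  set u : Set M := φ.source ∩ φ ⁻¹' Metric.ball (φ p) (2 * r)
  have hu : IsOpen u :=
    (continuousOn_extChartAt p).isOpen_inter_preimage (isOpen_extChartAt_source p) Metric.isOpen_ball
  have hau : φ.symm a ∈ u := ⟨φ.map_target haφ, by
    rw [Set.mem_preimage, φ.right_inv haφ]; exact hap⟩
  have hψ : CMDiff[u] ∞ fun x ↦ dist a z ^ 2 - ‖φ x - z‖ ^ 2 - ‖φ x - a‖ ^ 2 := by
    have h1 : CMDiff[u] ∞ φ := (contMDiffOn_extChartAt (n := ∞) (x := p)).mono fun x hx ↦ by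
      simpa [φ] using hx.1
    have h2 : ContDiff ℝ ∞ fun b : E ↦ dist a z ^ 2 - ‖b - z‖ ^ 2 - ‖b - a‖ ^ 2 :=
      (contDiff_const.sub ((contDiff_id.sub contDiff_const).norm_sq ℝ)).sub
        ((contDiff_id.sub contDiff_const).norm_sq ℝ)
    exact h2.contMDiff.comp_contMDiffOn h1
  obtain ⟨b, hbu, hba, hb0, hbh⟩ := exists_eq_max_of_divergence_grad_nonneg hh hsub
    (fun x ↦ hah ▸ hle x) hu hau hψ (by simp [φ.right_inv haφ, dist_eq_norm])
    (grad_sub_sq_norm_extChartAt_ne_zero haφ haz)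
  have h1 : dist a z ≤ dist (φ b) z := hmin ⟨Metric.ball_subset_closedBall hbu.2, by
    change h (φ.symm (φ b)) = h p
    rw [φ.left_inv hbu.1, hbh, hah]⟩
  rw [dist_eq_norm (φ b)] at h1
  have h2 : ‖φ b - a‖ ^ 2 ≤ 0 := by
    have h3 := pow_le_pow_left₀ dist_nonneg h1 2
    linarith
  have h4 : φ b = a := by
    rw [← sub_eq_zero, ← norm_eq_zero]
    exact pow_eq_zero_iff two_ne_zero |>.1 (le_antisymm h2 (by positivity))
  exact hba (by rw [← h4, φ.left_inv hbu.1])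

/-- **Strong maximum principle**: a subharmonic function on a compact connected Riemannian manifold
is constant. -/
theorem exists_eq_const_of_divergence_grad_nonneg [ConnectedSpace M] {h : M → ℝ}
    (hh : CMDiff ∞ h) (hsub : ∀ x, 0 ≤ divergence (fun y ↦ (grad h y : TangentSpace I y)) x) :
    ∃ c, ∀ x, h x = c := by
  obtain ⟨p, -, hp⟩ := isCompact_univ.exists_isMaxOn Set.univ_nonempty hh.continuous.continuousOn
  have hp : ∀ x, h x ≤ h p := fun x ↦ hp (Set.mem_univ x)
  have hclopen : IsClopen {x | h x = h p} :=
    ⟨isClosed_eq hh.continuous continuous_const, isOpen_iff_mem_nhds.2 fun x (hx : h x = h p) ↦ by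
      have := eventually_eq_max_of_divergence_grad_nonneg hh hsub (p := x) (hx ▸ hp)
      rwa [hx] at this⟩
  exact ⟨h p, fun x ↦ Set.eq_univ_iff_forall.1 (hclopen.eq_univ ⟨p, rfl⟩) x⟩

end StrongMaximumPrinciple

/-! ### Quasi-Einstein structures -/

theorem lieDerivMetric_eq {X : Π x : M, TangentSpace I x} {x : M} (hX : MDiffAt (T% X) x)
    (v w : TangentSpace I x) :
    lieDerivMetric X x v w
      = inner ℝ (leviCivita I M X x v) w + inner ℝ v (leviCivita I M X x w) := by
  have hv := mdifferentiableAt_extend I E v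
  have hw := mdifferentiableAt_extend I E w
  have htor : ∀ {Y : Π x : M, TangentSpace I x}, MDiffAt (T% Y) x →
      leviCivita I M Y x (X x) - leviCivita I M X x (Y x) = mlieBracket I X Y x := fun hY ↦
    (CovariantDerivative.torsion_eq_zero_iff (leviCivita I M)).1 leviCivita_torsion hX hY
  rw [lieDerivMetric, mvfderiv_inner_eq hX hv hw, ← htor hv, ← htor hw]
  simp only [extend_apply_self, inner_sub_left, inner_sub_right]
  ring

variable {m : ℝ≥0∞} {lam : ℝ} {X : Π x : M, TangentSpace I x} {f : M → ℝ}

/-- The difference of the quasi-Einstein equations of `X` and of `∇f`, on the diagonal: the Ricci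
tensor and the metric drop out. -/
theorem IsQuasiEinstein.inner_leviCivita_sub_grad (hX : IsQuasiEinstein m lam X)
    (hf : IsPotentialFunction I m lam f) (x : M) (v : TangentSpace I x) :
    inner ℝ (leviCivita I M (X - fun y ↦ grad f y) x v) v
      = (m⁻¹).toReal * (inner ℝ (X x) v ^ 2 - inner ℝ (grad f x) v ^ 2) := by
  have hXx : MDiffAt (T% X) x := hX.smooth.mdifferentiableAt (by simp)
  have hgx : MDiffAt (T% fun y ↦ (grad f y : TangentSpace I y)) x :=
    (contMDiff_grad hf.smooth).mdifferentiableAt (by simp)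
  have h1 := hX.eq x v v
  have h2 := hf.eq x v v
  rw [lieDerivMetric_eq hXx, real_inner_comm _ v] at h1
  rw [hessian, ← inner_grad] at h2
  rw [leviCivita_sub hXx hgx]
  change inner ℝ (leviCivita I M X x v - leviCivita I M (grad f) x v) v = _
  rw [inner_sub_left]
  linarith

/-- For finite `m` the field `Y = X - ∇f` vanishes. With `μ = 1/m`, the difference equation evaluated
on `Y` gives `Y |Y|² = 2 μ (|Y|⁴ + 2 |Y|² Y f)`, hence
`Y (exp (-4 μ f) |Y|²) = 2 μ exp (-4 μ f) |Y|⁴`. The left side is zero at a maximum point of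
`exp (-4 μ f) |Y|²`, so this function has maximum zero. -/
theorem IsQuasiEinstein.eq_grad_of_ne_top [T2Space M] [CompactSpace M] [BoundarylessManifold I M]
    (hX : IsQuasiEinstein m lam X) (hf : IsPotentialFunction I m lam f) (hm : m ≠ ⊤) (x : M) :
    X x = grad f x := by
  have hμ : 0 < (m⁻¹).toReal :=
    ENNReal.toReal_pos (ENNReal.inv_ne_zero.2 hm) (ENNReal.inv_ne_top.2 hX.pos.ne')
  set μ := (m⁻¹).toReal
  set Y : Π x : M, TangentSpace I x := X - fun y ↦ grad f y with hY
  have hYs : CMDiff ∞ (T% Y) := hX.smooth.sub_section (contMDiff_grad hf.smooth)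
  have hN : CMDiff ∞ fun y ↦ (inner ℝ (Y y) (Y y) : ℝ) :=
    contMDiffOn_univ.1 (contMDiffOn_inner hYs.contMDiffOn hYs.contMDiffOn)
  set ρ : M → ℝ := (fun s ↦ Real.exp (-4 * μ * s)) ∘ f with hρ
  have hρs : CMDiff ∞ ρ := ContMDiff.comp (g := fun s ↦ Real.exp (-4 * μ * s))
    (ContDiff.contMDiff (by fun_prop)) hf.smooth
  have hw : CMDiff ∞ fun y ↦ ρ y * inner ℝ (Y y) (Y y) := hρs.mul hN
  obtain ⟨q, -, hq⟩ := isCompact_univ.exists_isMaxOn ⟨x, Set.mem_univ x⟩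
    hw.continuous.continuousOn
  have hYd : MDiffAt (T% Y) q := hYs.mdifferentiableAt (by simp)
  have hcrit := mvfderiv_eq_zero_of_isLocalMax (I := I) (hw.mdifferentiableAt (by simp))
    (hq.isLocalMax Filter.univ_mem) (Y q)
  have hexp : HasDerivAt (fun s ↦ Real.exp (-4 * μ * s)) (-4 * μ * ρ q) (f q) :=
    (((hasDerivAt_id (f q)).const_mul (-4 * μ)).exp).congr_deriv (by simp [hρ]; ring)
  rw [mvfderiv_fun_mul (hρs.mdifferentiableAt (by simp)) (hN.mdifferentiableAt (by simp))] at hcrit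
  simp only [add_apply, smul_apply, smul_eq_mul] at hcrit
  rw [mvfderiv_inner_eq hYd hYd hYd, hρ,
    mvfderiv_comp_of_hasDerivAt hexp (hf.smooth.mdifferentiableAt (by simp)), ← hρ,
    real_inner_comm _ (Y q), hX.inner_leviCivita_sub_grad hf q, ← inner_grad] at hcrit
  have hXq : X q = Y q + grad f q := by simp [hY]
  rw [hXq, inner_add_left] at hcrit
  have hρq : 0 < ρ q := Real.exp_pos _
  -- The factor `-4 μ` in the exponent cancels the terms linear in `∇f`.
  have hsq : 2 * μ * ρ q * inner ℝ (Y q) (Y q) ^ 2 = 0 := by linear_combination hcrit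
  have hNq : inner ℝ (Y q) (Y q) = 0 := by
    simpa [hμ.ne', hρq.ne'] using hsq
  have hle := hq (Set.mem_univ x)
  simp only [Set.mem_ofPred_eq, hNq, mul_zero] at hle
  have hNx : inner ℝ (Y x) (Y x) ≤ 0 := by
    by_contra! h
    exact absurd hle (not_le.2 (mul_pos (Real.exp_pos _) h))
  have hYx : Y x = 0 := inner_self_eq_zero.1 (le_antisymm hNx real_inner_self_nonneg)
  exact sub_eq_zero.1 hYx

/-- For `m = ∞` this is the trace of the difference equation, whose right side carries the factor
`1/∞ = 0`; for finite `m` the field itself vanishes. -/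
theorem IsQuasiEinstein.divergence_sub_grad [T2Space M] [CompactSpace M] [BoundarylessManifold I M]
    (hX : IsQuasiEinstein m lam X) (hf : IsPotentialFunction I m lam f) (x : M) :
    divergence (X - fun y ↦ grad f y) x = 0 := by
  rcases eq_or_ne m ⊤ with rfl | hm
  · rw [divergence_eq_sum_inner (stdOrthonormalBasis ℝ (TangentSpace I x))]
    simp [hX.inner_leviCivita_sub_grad hf]
  · have h : (X - fun y ↦ grad f y) = 0 := funext fun y ↦
      sub_eq_zero.2 (hX.eq_grad_of_ne_top hf hm y)
    rw [h, divergence, CovariantDerivative.zero]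
    simp

theorem IsQuasiEinstein.isHodgeDeRhamPotential [T2Space M] [CompactSpace M]
    [BoundarylessManifold I M] (hX : IsQuasiEinstein m lam X)
    (hf : IsPotentialFunction I m lam f) : IsHodgeDeRhamPotential X f where
  smooth := hf.smooth
  decomposition := ⟨X - fun y ↦ grad f y, hX.smooth.sub_section (contMDiff_grad hf.smooth),
    hX.divergence_sub_grad hf, fun x ↦ by simp⟩

theorem IsHodgeDeRhamPotential.divergence_eq {ξ : M → ℝ} (hξ : IsHodgeDeRhamPotential X ξ)
    (x : M) : divergence X x = divergence (fun y ↦ (grad ξ y : TangentSpace I y)) x := by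
  obtain ⟨W, hW, hdiv, hdec⟩ := hξ.decomposition
  rw [show X = W + fun y ↦ grad ξ y from funext hdec,
    divergence_add (hW.mdifferentiableAt (by simp))
      ((contMDiff_grad hξ.smooth).mdifferentiableAt (by simp)), hdiv, zero_add]

theorem IsHodgeDeRhamPotential.divergence_grad_sub [T2Space M] {ξ ξ' : M → ℝ}
    (hξ : IsHodgeDeRhamPotential X ξ) (hξ' : IsHodgeDeRhamPotential X ξ') (x : M) :
    divergence (fun y ↦ (grad (ξ - ξ') y : TangentSpace I y)) x = 0 := by
  have h := divergence_grad_add (I := I) isOpen_univ (Set.mem_univ x)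
    (hξ.smooth.sub hξ'.smooth).contMDiffOn hξ'.smooth.contMDiffOn
  have h2 : (fun y ↦ ξ y - ξ' y) + ξ' = ξ := by ext; simp
  rw [h2, ← hξ.divergence_eq, ← hξ'.divergence_eq] at h
  exact (add_eq_right.1 h.symm)

end QuasiEinstein
end

theorem mainTheorem3 {n : ℕ} (hn : 2 < n)
    {M : Type*} [TopologicalSpace M] [T2Space M] [CompactSpace M] [ConnectedSpace M]
    [ChartedSpace (EuclideanSpace ℝ (Fin n)) M] [IsManifold (𝓡 n) ∞ M]
    [RiemannianBundle (fun x : M ↦ TangentSpace (𝓡 n) x)]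
    [IsContMDiffRiemannianBundle (𝓡 n) ∞ (EuclideanSpace ℝ (Fin n))
      (fun x : M ↦ TangentSpace (𝓡 n) x)]
    (m : ℝ≥0∞) (lam : ℝ) (X : Π x : M, TangentSpace (𝓡 n) x)
    (hX : QuasiEinstein.IsQuasiEinstein m lam X)
    (f : M → ℝ) (hf : QuasiEinstein.IsPotentialFunction (𝓡 n) m lam f) :
    (∃ ξ : M → ℝ, QuasiEinstein.IsHodgeDeRhamPotential X ξ) ∧
      ∀ ξ : M → ℝ, QuasiEinstein.IsHodgeDeRhamPotential X ξ →
        ∃ c : ℝ, ∀ x : M, f x = ξ x + c := by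
  have hfX := hX.isHodgeDeRhamPotential hf
  refine ⟨⟨f, hfX⟩, fun ξ hξ ↦ ?_⟩
  obtain ⟨c, hc⟩ := QuasiEinstein.exists_eq_const_of_divergence_grad_nonneg
    (hfX.smooth.sub hξ.smooth) fun x ↦ (hfX.divergence_grad_sub hξ x).ge
  exact ⟨c, fun x ↦ by linarith [hc x]⟩
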